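/- Let $T$ be a complete first-order theory in a language $L$, let $x,y$ be (possibly infinite) tuples of variables, and let $\varphi(x,y)$ be a partitioned $L$-formula which is stable in $T$, i.e. in no model of $T$ are there tuples $a_i,b_i$ ($i<\omega$) such that, for all $i,j<\omega$, $\varphi(a_i,b_j)$ holds if and only if $i<j$. Let $M\models T$ (for example a monster model of $T$) and let $A\subseteq C\subseteq M$. A $\varphi$-formula over $A$ is a formula $\psi(x)$ with parameters in $A$ which is equivalent in $M$ to a Boolean combination of instances $\varphi(x,c)$ with $c$ a tuple from $C$. (The choices $C=A$ and $C=M$ give the two usual conventions.) Let $L_{\varphi,x}(A)$ be the Boolean algebra of $\varphi$-formulas over $A$ up to equivalence in $M$, and let $S^x_\varphi(A)$ be the set of complete $\varphi$-types over $A$, i.e. of maximal consistent sets of $\varphi$-formulas over $A$. For $r\in S^x_\varphi(A)$ and $\psi\in L_{\varphi,x}(A)$ put $r(\psi)=1$ if $\psi\in r$ and $r(\psi)=0$ otherwise. Let $\mathcal B$ be a complete Boolean algebra and let $q$ be a $\mathcal B,\varphi$-type over $A$, i.e. a homomorphism of Boolean algebras $q:L_{\varphi,x}(A)\to\mathcal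 B$. Let $$\operatorname{supp}_\varphi(q)=\{p\in S^x_\varphi(A) : q(\theta)>0 \text{ for every } \theta\in L_{\varphi,x}(A) \text{ with } p\vdash\theta\}.$$ Then there are a set $U\subseteq\operatorname{supp}_\varphi(q)$ and a maximal antichain $\langle \mathfrak b_r : r\in U\rangle$ in $\mathcal B$ (nonzero, pairwise disjoint elements for distinct indices, such that no nonzero element of $\mathcal B$ is disjoint from all of them) such that for every $\psi\in L_{\varphi,x}(A)$ $$q(\psi)=\sum_{r\in U}\mathfrak b_r\cdot r(\psi),$$ where $\sum$ denotes the supremum and $\cdot$ the meet in $\mathcal B$. -/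

import Mathlib

open FirstOrder

universe u v w x y z

namespace BooleanType

/-- The partitioned formula `φ(x, y)` is stable in `T`: in no model of `T` are there sequences of
tuples `aᵢ`, `bᵢ` (`i < ω`) such that `φ(aᵢ, bⱼ)` holds exactly when `i < j`.  By the
Löwenheim–Skolem theorem, models in the universe used here are representative of all models. -/
def IsStable {L : FirstOrder.Language.{u, v}} (T : L.Theory) {X : Type x} {Y : Type y}
    (φ : L.Formula (X ⊕ Y)) : Prop :=
  ∀ N : FirstOrder.Language.Theory.ModelType.{u, v, max u v x y} T,
    ¬ ∃ (a : ℕ → X → N) (b : ℕ → Y → N),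
      ∀ i j : ℕ, φ.Realize (Sum.elim (a i) (b j)) ↔ i < j

section Local

variable {L : FirstOrder.Language.{u, v}} {M : Type w} [L.Structure M] {X : Type x} {Y : Type y}

variable (L X) in
/-- The Boolean algebra of subsets of `M^X` definable over `A`, i.e. of formulas over `A` in the
variables `X` up to equivalence in `M`. -/
def definableAlgebra (A : Set M) : BooleanSubalgebra (Set (X → M)) where
  carrier := {S | A.Definable L S}
  supClosed' := fun _ hS _ hS' => hS.union hS'
  infClosed' := fun _ hS _ hS' => hS.inter hS'
  compl_mem' := fun hS => hS.compl
  bot_mem' := Set.definable_empty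

/-- The set defined in `M` by the instance `φ(x, c)`. -/
def instanceSet (φ : L.Formula (X ⊕ Y)) (c : Y → M) : Set (X → M) :=
  {a | φ.Realize (Sum.elim a c)}

/-- The Boolean algebra of `φ`-formulas over `A`, up to equivalence in `M`: formulas over `A`
equivalent to a Boolean combination of instances `φ(x, c)`, with `c` a tuple from `C`. -/
def phiAlgebra (φ : L.Formula (X ⊕ Y)) (A C : Set M) : BooleanSubalgebra (Set (X → M)) :=
  definableAlgebra L X A ⊓
    BooleanSubalgebra.closure {S | ∃ c : Y → M, (∀ i, c i ∈ C) ∧ S = instanceSet φ c}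

/-- A set `p` of `φ`-formulas entails the `φ`-formula `θ`: a finite conjunction of members of `p`
implies `θ`. -/
def Entails {φ : L.Formula (X ⊕ Y)} {A C : Set M} (p : Set (phiAlgebra φ A C))
    (θ : phiAlgebra φ A C) : Prop :=
  ∃ s : Finset (phiAlgebra φ A C), ↑s ⊆ p ∧ s.inf id ≤ θ

/-- A set of `φ`-formulas is consistent if it does not entail the contradiction. -/
def Consistent {φ : L.Formula (X ⊕ Y)} {A C : Set M} (p : Set (phiAlgebra φ A C)) : Prop :=
  ¬ Entails p ⊥

/-- Complete `φ`-types over `A`: maximal consistent sets of `φ`-formulas over `A`. -/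
def PhiType (φ : L.Formula (X ⊕ Y)) (A C : Set M) : Type (max w x) :=
  {p : Set (phiAlgebra φ A C) // Maximal Consistent p}

open Classical in
/-- A complete `φ`-type viewed as a `{0, 1}`-valued type, with values in a Boolean algebra. -/
noncomputable def PhiType.val {φ : L.Formula (X ⊕ Y)} {A C : Set M} (r : PhiType φ A C)
    (B : Type z) [BooleanAlgebra B] (ψ : phiAlgebra φ A C) : B :=
  if ψ ∈ r.1 then ⊤ else ⊥

/-- A `B, φ`-type over `A`: a homomorphism of Boolean algebras from the algebra of `φ`-formulas
over `A` to `B`. -/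
abbrev BoolPhiType (φ : L.Formula (X ⊕ Y)) (A C : Set M) (B : Type z) [BooleanAlgebra B] :
    Type (max w x z) :=
  BoundedLatticeHom (phiAlgebra φ A C) B

/-- The support of a `B, φ`-type `q`: the complete `φ`-types entailing only `φ`-formulas to
which `q` gives a nonzero value. -/
def supp {φ : L.Formula (X ⊕ Y)} {A C : Set M} {B : Type z} [BooleanAlgebra B]
    (q : BoolPhiType φ A C B) : Set (PhiType φ A C) :=
  {p | ∀ θ, Entails p.1 θ → ⊥ < q θ}

end Local

/-- An indexed maximal antichain of a Boolean algebra: nonzero, pairwise disjoint elements such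
that no nonzero element is disjoint from all of them. -/
structure IsMaximalAntichain {B : Type z} [BooleanAlgebra B] {ι : Type w} (b : ι → B) : Prop where
  ne_bot : ∀ i, b i ≠ ⊥
  disjoint : ∀ i j, i ≠ j → Disjoint (b i) (b j)
  maximal : ∀ c : B, c ≠ ⊥ → ∃ i, ¬ Disjoint c (b i)

end BooleanType

open Filter Set

namespace BooleanType

/-! ### Trees and ladders of a binary relation -/

section Combinatorics

variable {α : Type*} {β : Type*} (R : α → β → Prop)

/-! It suffices that below every nonzero `b` some nonzero `c` decides `q`. Such a `c` induces the
complete type `{ψ | c ≤ q ψ}` and lies below its `weight`, so the nonzero weights form the required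
antichain (`exists_maximalAntichain_of_dense`).

Stability supplies the deciding elements. By Hodges' lemma (`HasTree.ladder`) and compactness, trees
of `φ`-instances have bounded height. Take a finest filter `F` on `X → M` whose members in the
algebra all have value at least `b`. An `F`-positive set `S` of least tree rank is not split by any
instance into two positive halves, so `F` restricted to `S` decides every `φ`-formula. Since `F` is
finest, its restriction to `Sᶜ` contains some `e` with `¬ b ≤ q e`, and then `b \ q e` decides `q`
(`exists_le_decides`). Using all subsets of `X → M` allows instances that are not over `A`. -/

/-- There is a full binary tree of height `n` with nodes in `N`, each of whose branches is
realized by an element of `S`. -/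
def HasTree : ℕ → Set α → Set β → Prop
  | 0, S, _ => S.Nonempty
  | n + 1, S, N => ∃ c ∈ N, HasTree n (S ∩ {a | R a c}) N ∧ HasTree n (S \ {a | R a c}) N

/-- There are `n` pairs `(aᵢ, bᵢ)` in `S × N` with `R aᵢ bⱼ ↔ i ≤ j`. -/
def HasLeftLadder : ℕ → Set α → Set β → Prop
  | 0, _, _ => True
  | n + 1, S, N => ∃ a ∈ S, ∃ c ∈ N, R a c ∧ HasLeftLadder n (S \ {a | R a c}) (N ∩ {c | R a c})

variable {R}

lemma HasTree.mono {n : ℕ} {S S' : Set α} {N N' : Set β} (h : HasTree R n S N)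
    (hS : S ⊆ S') (hN : N ⊆ N') : HasTree R n S' N' := by
  induction n generalizing S S' with
  | zero => exact Set.Nonempty.mono hS h
  | succ n ih =>
    obtain ⟨c, hc, h1, h2⟩ := h
    exact ⟨c, hN hc, ih h1 (inter_subset_inter_left _ hS), ih h2 (sdiff_subset_sdiff_left hS)⟩

lemma HasTree.nonempty {n : ℕ} {S : Set α} {N : Set β} (h : HasTree R n S N) : S.Nonempty := by
  induction n generalizing S with
  | zero => exact h
  | succ n ih =>
    obtain ⟨c, -, h1, -⟩ := h
    exact (ih h1).mono inter_subset_left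

lemma HasLeftLadder.mono {n : ℕ} {S S' : Set α} {N N' : Set β} (h : HasLeftLadder R n S N)
    (hS : S ⊆ S') (hN : N ⊆ N') : HasLeftLadder R n S' N' := by
  induction n generalizing S S' N N' with
  | zero => trivial
  | succ n ih =>
    obtain ⟨a, ha, c, hc, hac, h⟩ := h
    exact ⟨a, hS ha, c, hN hc, hac,
      ih h (sdiff_subset_sdiff_left hS) (inter_subset_inter_left _ hN)⟩

/-- If the nodes of a tree of height `n + k` are partitioned into two sets, then the first one
contains a tree of height `n` or the second one a tree of height `k`. -/
lemma HasTree.partition {m n k : ℕ} (hm : m = n + k) {S : Set α} {N : Set β}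
    (h : HasTree R m S N) (P : Set β) : HasTree R n S (N ∩ P) ∨ HasTree R k S (N \ P) := by
  induction m generalizing n k S with
  | zero =>
    obtain rfl : n = 0 := by omega
    exact Or.inl h
  | succ m ih =>
    have hne : S.Nonempty := h.nonempty
    obtain ⟨c, hc, h1, h2⟩ := h
    -- The side containing the root is the one whose target height drops: two shorter trees on that
    -- side are joined at `c`, and a tree on the other side is already high enough.
    by_cases hP : c ∈ P
    · cases n with
      | zero => exact Or.inl hne
      | succ n =>
        rcases ih (n := n) (k := k) (by omega) h1 with h1 | h1
        · rcases ih (n := n) (k := k) (by omega) h2 with h2 | h2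
          · exact Or.inl ⟨c, ⟨hc, hP⟩, h1, h2⟩
          · exact Or.inr (h2.mono sdiff_subset subset_rfl)
        · exact Or.inr (h1.mono inter_subset_left subset_rfl)
    · cases k with
      | zero => exact Or.inr hne
      | succ k =>
        rcases ih (n := n) (k := k) (by omega) h1 with h1 | h1
        · exact Or.inl (h1.mono inter_subset_left subset_rfl)
        · rcases ih (n := n) (k := k) (by omega) h2 with h2 | h2
          · exact Or.inl (h2.mono sdiff_subset subset_rfl)
          · exact Or.inr ⟨c, ⟨hc, hP⟩, h1, h2⟩

/-- A tree height which forces ladders of total length `k`. -/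
def ladderHeight : ℕ → ℕ
  | 0 => 0
  | k + 1 => 2 * (ladderHeight k + 1)

/-- Hodges' lemma: a sufficiently high tree yields a long ladder, for the relation or for its
negation. -/
lemma HasTree.ladder {k l r : ℕ} (hk : k + 1 = l + r) {S : Set α} {N : Set β}
    (h : HasTree R (ladderHeight k) S N) :
    HasLeftLadder R l S N ∨ HasLeftLadder (fun a c => ¬ R a c) r S N := by
  induction k generalizing l r S N with
  | zero =>
    rcases l with - | l
    · exact Or.inl trivial
    · obtain rfl : r = 0 := by omega
      exact Or.inr trivial
  | succ k ih =>
    rcases l with - | l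
    · exact Or.inl trivial
    rcases r with - | r
    · exact Or.inr trivial
    -- The extra level in `ladderHeight k + 1` provides a root `c` with `R a c`, so `(a, c)` can
    -- head a ladder found in the right subtree.
    by_cases hb : ∃ a ∈ S, HasTree R (ladderHeight k + 1) S (N ∩ {c | R a c})
    · obtain ⟨a, ha, c, ⟨hc, hac⟩, -, h2⟩ := hb
      rcases ih (l := l) (r := r + 1) (by omega) h2 with h3 | h3
      · exact Or.inl ⟨a, ha, c, hc, hac, h3⟩
      · exact Or.inr (h3.mono sdiff_subset inter_subset_left)
    · rw [ladderHeight, two_mul, ← add_assoc] at h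
      obtain ⟨c, hc, h1, h2⟩ := h
      -- Now `¬ R a c`. Partitioning the left subtree by `R a`, failure of `hb` leaves a tree with
      -- nodes outside `R a`, where `(a, c)` heads a ladder for the negation.
      obtain ⟨a, ha, hac⟩ := h2.nonempty
      rcases h1.partition (n := ladderHeight k + 1) (k := ladderHeight k) (by omega)
        {c | R a c} with h3 | h3
      · exact absurd ⟨a, ha, h3.mono inter_subset_left subset_rfl⟩ hb
      rcases ih (l := l + 1) (r := r) (by omega) h3 with h4 | h4
      · exact Or.inl (h4.mono inter_subset_left sdiff_subset)
      · exact Or.inr ⟨a, ha, c, hc, hac, h4.mono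
          (fun x hx => ⟨hx.1, fun hn => hn hx.2⟩) subset_rfl⟩

lemma HasLeftLadder.exists_seq [Nonempty α] [Nonempty β] {n : ℕ} {S : Set α} {N : Set β}
    (h : HasLeftLadder R n S N) :
    ∃ (a : ℕ → α) (b : ℕ → β), (∀ i < n, a i ∈ S) ∧ (∀ i < n, b i ∈ N) ∧
      ∀ i < n, ∀ j < n, R (a i) (b j) ↔ i ≤ j := by
  induction n generalizing S N with
  | zero => exact ⟨fun _ => Classical.arbitrary α, fun _ => Classical.arbitrary β, by simp⟩
  | succ n ih =>
    obtain ⟨x, hx, y, hy, hxy, h⟩ := h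
    obtain ⟨a, b, ha, hb, hab⟩ := ih h
    refine ⟨fun i => i.casesOn x a, fun i => i.casesOn y b, ?_, ?_, ?_⟩
    · rintro (- | i) hi
      · exact hx
      · exact (ha i (by omega)).1
    · rintro (- | i) hi
      · exact hy
      · exact (hb i (by omega)).1
    · rintro (- | i) hi (- | j) hj
      · simpa using hxy
      · simpa using (hb j (by omega)).2
      · simpa using (ha i (by omega)).2
      · simpa using hab i (by omega) j (by omega)

/-- Trees of unbounded height yield ladders of unbounded length. -/
lemma exists_ladder_of_forall_hasTree [Nonempty α] [Nonempty β] {S : Set α} {N : Set β}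
    (h : ∀ n, HasTree R n S N) (n : ℕ) :
    ∃ (a : ℕ → α) (b : ℕ → β), ∀ i < n, ∀ j < n, R (a i) (b j) ↔ i < j := by
  rcases (h (ladderHeight (2 * n + 1))).ladder (l := n + 1) (r := n + 1) (by omega) with h | h
  · obtain ⟨a, b, -, -, hab⟩ := h.exists_seq
    exact ⟨fun i => a (i + 1), b, fun i hi j hj => by
      rw [hab _ (by omega) _ (by omega)]; omega⟩
  · obtain ⟨a, b, -, -, hab⟩ := h.exists_seq
    -- Reversing the indices turns `¬ R ↔ i ≤ j` into `R ↔ i < j`.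
    refine ⟨fun i => a (n - i), fun j => b (n - j), fun i hi j hj => ?_⟩
    rw [← not_iff_not, hab _ (by omega) _ (by omega)]
    omega

end Combinatorics

/-! ### Stability bounds the height of trees -/

section Compactness

open FirstOrder.Language

variable {L : FirstOrder.Language.{u, v}} {X : Type x} {Y : Type y}

/-- The formula expressing that the `i`-th and the `j`-th tuple are related by `φ` exactly if
`i < j`. -/
def ladderFormula (φ : L.Formula (X ⊕ Y)) (i j : ℕ) : L.Formula ((ℕ × X) ⊕ (ℕ × Y)) :=
  if i < j then φ.relabel (Sum.map (Prod.mk i) (Prod.mk j))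
  else (φ.relabel (Sum.map (Prod.mk i) (Prod.mk j))).not

lemma realize_ladderFormula {φ : L.Formula (X ⊕ Y)} {i j : ℕ} {N : Type*} [L.Structure N]
    (f : (ℕ × X) ⊕ (ℕ × Y) → N) :
    (ladderFormula φ i j).Realize f ↔
      (φ.Realize (Sum.elim (fun k => f (.inl (i, k))) (fun k => f (.inr (j, k)))) ↔ i < j) := by
  have : f ∘ Sum.map (Prod.mk i) (Prod.mk j) =
      Sum.elim (fun k => f (.inl (i, k))) (fun k => f (.inr (j, k))) := by
    ext (k | k) <;> rfl
  unfold ladderFormula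
  split_ifs with h <;> simp [Formula.realize_relabel, Formula.realize_not, this, h]

/-- The theory of a model of `T` with a `φ`-ladder of length `n`. -/
def ladderTheory (T : L.Theory) (φ : L.Formula (X ⊕ Y)) (n : ℕ) :
    (L[[(ℕ × X) ⊕ (ℕ × Y)]]).Theory :=
  (L.lhomWithConstants ((ℕ × X) ⊕ (ℕ × Y))).onTheory T ∪
    {σ | ∃ i < n, ∃ j < n, σ = Formula.equivSentence (ladderFormula φ i j)}

lemma ladderTheory_mono (T : L.Theory) (φ : L.Formula (X ⊕ Y)) : Monotone (ladderTheory T φ) := by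
  rintro m n hmn σ (hσ | ⟨i, hi, j, hj, rfl⟩)
  · exact Or.inl hσ
  · exact Or.inr ⟨i, hi.trans_le hmn, j, hj.trans_le hmn, rfl⟩

lemma ladderTheory_isSatisfiable {T : L.Theory} {φ : L.Formula (X ⊕ Y)} {M : Type w}
    [L.Structure M] [Nonempty M] (hM : M ⊨ T) {n : ℕ} {a : ℕ → X → M} {b : ℕ → Y → M}
    (hab : ∀ i < n, ∀ j < n, φ.Realize (Sum.elim (a i) (b j)) ↔ i < j) :
    (ladderTheory T φ n).IsSatisfiable := by
  let f : (ℕ × X) ⊕ (ℕ × Y) → M := Sum.elim (fun k => a k.1 k.2) (fun k => b k.1 k.2)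
  let : (constantsOn ((ℕ × X) ⊕ (ℕ × Y))).Structure M := constantsOn.structure f
  have : M ⊨ ladderTheory T φ n := by
    refine Theory.model_union_iff.2 ⟨(LHom.onTheory_model _ T).2 hM, ⟨?_⟩⟩
    rintro σ ⟨i, hi, j, hj, rfl⟩
    rw [Formula.realize_equivSentence, realize_ladderFormula]
    exact hab i hi j hj
  exact Theory.Model.isSatisfiable M

/-- A stable formula does not admit arbitrarily high trees in a model of the theory. -/
lemma IsStable.exists_not_hasTree {T : L.Theory} {φ : L.Formula (X ⊕ Y)} (hφ : IsStable T φ)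
    {M : Type w} [L.Structure M] [Nonempty M] (hM : M ⊨ T) :
    ∃ n, ¬ HasTree (fun (a : X → M) (c : Y → M) => a ∈ instanceSet φ c) n univ univ := by
  by_contra! h
  have hsat : Theory.IsSatisfiable (⋃ n, ladderTheory T φ n) := by
    rw [Theory.isSatisfiable_directed_union_iff (ladderTheory_mono T φ).directed_le]
    intro n
    obtain ⟨a, b, hab⟩ := exists_ladder_of_forall_hasTree h n
    exact ladderTheory_isSatisfiable hM hab
  -- This model lives in the universe over which `IsStable` quantifies, whatever the universe of
  -- `M`.
  obtain ⟨N⟩ := hsat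
  have hN : ∀ n, N ⊨ ladderTheory T φ n := fun n =>
    Theory.Model.mono N.is_model (subset_iUnion _ n)
  let : L.Structure N := (L.lhomWithConstants ((ℕ × X) ⊕ (ℕ × Y))).reduct N
  have : (L.lhomWithConstants ((ℕ × X) ⊕ (ℕ × Y))).IsExpansionOn N := LHom.isExpansionOn_reduct _ _
  have hNT : N ⊨ T := (LHom.onTheory_model _ T).1 (Theory.model_union_iff.1 (hN 0)).1
  refine hφ (Theory.ModelType.of T N)
    ⟨fun i k => ((L.con (Sum.inl (i, k) : (ℕ × X) ⊕ (ℕ × Y)) :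
        (L[[(ℕ × X) ⊕ (ℕ × Y)]]).Constants) : N),
      fun j k => ((L.con (Sum.inr (j, k) : (ℕ × X) ⊕ (ℕ × Y)) :
        (L[[(ℕ × X) ⊕ (ℕ × Y)]]).Constants) : N), fun i j => ?_⟩
  have := (Theory.model_union_iff.1 (hN (max i j + 1))).2.realize_of_mem _
    ⟨i, by omega, j, by omega, rfl⟩
  rw [Formula.realize_equivSentence, realize_ladderFormula] at this
  exact this

end Compactness

/-! ### Complete `φ`-types -/

section Types

variable {L : FirstOrder.Language.{u, v}} {M : Type w} [L.Structure M] {X : Type x} {Y : Type y}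
  {φ : L.Formula (X ⊕ Y)} {A C : Set M}

lemma Entails.of_mem {p : Set (phiAlgebra φ A C)} {θ : phiAlgebra φ A C} (h : θ ∈ p) :
    Entails p θ :=
  ⟨{θ}, by simpa using h, by simp⟩

lemma Consistent.not_entails_compl {p : Set (phiAlgebra φ A C)} (hp : Consistent p)
    {θ : phiAlgebra φ A C} (h : Entails p θ) : ¬ Entails p θᶜ := by
  classical
  rintro ⟨t, ht, ht'⟩
  obtain ⟨s, hs, hs'⟩ := h
  refine hp ⟨s ∪ t, by simp [hs, ht], ?_⟩
  rw [Finset.inf_union]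
  exact (inf_le_inf hs' ht').trans (inf_compl_eq_bot (a := θ)).le

namespace PhiType

variable (r : PhiType φ A C) {θ : phiAlgebra φ A C}

lemma entails_compl_of_notMem (h : θ ∉ r.1) : Entails r.1 θᶜ := by
  classical
  have : ¬ Consistent (insert θ r.1) := fun hc =>
    h (r.2.2 hc (subset_insert _ _) (mem_insert _ _))
  obtain ⟨s, hs, hs'⟩ := not_not.1 this
  refine ⟨s.erase θ, fun ψ hψ => ?_, ?_⟩
  · rw [Finset.mem_coe, Finset.mem_erase] at hψ
    exact (hs hψ.2).resolve_left hψ.1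
  · rw [le_compl_iff_disjoint_left, disjoint_iff_inf_le]
    refine le_trans ?_ hs'
    refine Finset.le_inf fun ψ hψ => ?_
    by_cases hθ : ψ = θ
    · exact hθ ▸ inf_le_left
    · exact inf_le_right.trans (Finset.inf_le (Finset.mem_erase.2 ⟨hθ, hψ⟩))

lemma mem_of_entails (h : Entails r.1 θ) : θ ∈ r.1 :=
  by_contra fun hθ => r.2.1.not_entails_compl h (r.entails_compl_of_notMem hθ)

lemma compl_mem_of_notMem (h : θ ∉ r.1) : θᶜ ∈ r.1 :=
  r.mem_of_entails (r.entails_compl_of_notMem h)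

end PhiType

variable {B : Type z} [CompleteBooleanAlgebra B] (q : BoolPhiType φ A C B)

/-- A nonzero element of `B` decides `q` if it is below the value of each formula or below the
complement of that value. -/
def Decides (b : B) : Prop :=
  b ≠ ⊥ ∧ ∀ ψ, b ≤ q ψ ∨ b ≤ q ψᶜ

-- A consistent extension containing a new `ψ` would also contain `ψᶜ`, since `b` decides `ψ`.
variable {q} in
lemma Decides.maximal_consistent {b : B} (hb : Decides q b) :
    Maximal Consistent {ψ : phiAlgebra φ A C | b ≤ q ψ} := by
  refine ⟨?_, fun p hp hle ψ hψ => ?_⟩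
  · rintro ⟨s, hs, hs'⟩
    refine hb.1 (le_bot_iff.1 ?_)
    calc b ≤ s.inf (q ∘ id) := Finset.le_inf fun ψ hψ => hs hψ
      _ = q (s.inf id) := (map_finset_inf q s id).symm
      _ ≤ q ⊥ := OrderHomClass.mono q hs'
      _ = ⊥ := map_bot q
  · refine (hb.2 ψ).resolve_right fun h => ?_
    exact hp.not_entails_compl (.of_mem hψ) (.of_mem (hle h))

/-- The largest element of `B` below all values of `q` at members of the type `r`. -/
noncomputable def weight (r : PhiType φ A C) : B :=
  ⨅ ψ ∈ r.1, q ψ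

variable {q} in
lemma weight_le {r : PhiType φ A C} {ψ : phiAlgebra φ A C} (h : ψ ∈ r.1) : weight q r ≤ q ψ :=
  iInf₂_le ψ h

/-- If the deciding elements are dense in `B`, then `q` is a mixture of complete types. -/
lemma exists_maximalAntichain_of_dense (h : ∀ b : B, b ≠ ⊥ → ∃ c ≤ b, Decides q c) :
    ∃ (U : Set (PhiType φ A C)) (b : U → B),
      U ⊆ supp q ∧ IsMaximalAntichain b ∧
        ∀ ψ : phiAlgebra φ A C, q ψ = ⨆ r : U, b r ⊓ r.1.val B ψ := by
  have key : ∀ b : B, b ≠ ⊥ → ∃ c ≤ b, c ≠ ⊥ ∧ ∃ r : PhiType φ A C,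
      c ≤ weight q r ∧ ∀ ψ, c ≤ q ψ → ψ ∈ r.1 := fun b hb => by
    obtain ⟨c, hcb, hc⟩ := h b hb
    exact ⟨c, hcb, hc.1, ⟨_, hc.maximal_consistent⟩, le_iInf₂ fun _ hψ => hψ, fun _ hψ => hψ⟩
  refine ⟨{r | weight q r ≠ ⊥}, fun r => weight q r.1, fun r hr θ hθ => ?_,
    ⟨fun r => r.2, fun r s hrs => ?_, fun b hb => ?_⟩, fun ψ => le_antisymm ?_ ?_⟩
  · exact (bot_lt_iff_ne_bot.2 hr).trans_le (weight_le (r.mem_of_entails hθ))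
  · obtain ⟨ψ, hr, hs⟩ : ∃ ψ ∈ r.1.1, ψ ∉ s.1.1 := not_subset.1 fun hle =>
      hrs (Subtype.ext (Subtype.ext (r.1.2.eq_of_subset s.1.2.1 hle)))
    have : Disjoint (q ψ) (q ψᶜ) := by
      rw [disjoint_iff, ← map_inf q ψ ψᶜ, inf_compl_eq_bot]
      exact map_bot q
    exact this.mono (weight_le hr) (weight_le (s.1.compl_mem_of_notMem hs))
  · obtain ⟨c, hcb, hc, r, hr, -⟩ := key b hb
    exact ⟨⟨r, fun h0 => hc (le_bot_iff.1 (h0 ▸ hr))⟩, fun hd => hc (le_bot_iff.1 (hd hcb hr))⟩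
  -- A deciding element below the difference would lie below the weight of a type containing `ψ`,
  -- hence below the supremum.
  · rw [← sdiff_eq_bot_iff]
    by_contra hne
    obtain ⟨c, hcb, hc, r, hr, hmem⟩ := key _ hne
    have hψ : ψ ∈ r.1 := hmem ψ (hcb.trans sdiff_le)
    have hU : weight q r ≠ ⊥ := fun h0 => hc (le_bot_iff.1 (h0 ▸ hr))
    refine hc (le_bot_iff.1 (disjoint_sdiff_self_left hcb (hr.trans ?_)))
    refine le_trans (le_of_eq ?_)
      (le_iSup (fun r : {r | weight q r ≠ ⊥} => weight q r.1 ⊓ r.1.val B ψ) ⟨r, hU⟩)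
    simp [PhiType.val, hψ]
  · refine iSup_le fun r => ?_
    by_cases hψ : ψ ∈ r.1.1
    · exact inf_le_left.trans (weight_le hψ)
    · simp [PhiType.val, hψ]

end Types

/-! ### Density of deciding elements -/

section Density

/-- A proper filter on the underlying set of a relation without arbitrarily high trees has a
positive set which decides all instances modulo the filter. -/
lemma exists_positive_deciding {α : Type*} {β : Type*} {R : α → β → Prop} {n : ℕ}
    (hn : ¬ HasTree R n univ univ) (F : Filter α) [F.NeBot] :
    ∃ S : Set α, (F ⊓ 𝓟 S).NeBot ∧
      ∀ c, {a | R a c} ∈ F ⊓ 𝓟 S ∨ {a | R a c}ᶜ ∈ F ⊓ 𝓟 S := by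
  classical
  have hex : ∃ n, ∃ S : Set α, (F ⊓ 𝓟 S).NeBot ∧ ¬ HasTree R n S univ :=
    ⟨n, univ, by simpa, hn⟩
  obtain ⟨S, hS, hSn⟩ := Nat.find_spec hex
  refine ⟨S, hS, fun c => ?_⟩
  obtain ⟨m, hm⟩ : ∃ m, Nat.find hex = m + 1 := by
    refine Nat.exists_eq_succ_of_ne_zero fun h0 => ?_
    rw [h0] at hSn
    exact hSn (nonempty_of_mem (f := F ⊓ 𝓟 S) (mem_inf_of_right (mem_principal_self S)))
  have hmin : ∀ S' : Set α, (F ⊓ 𝓟 S').NeBot → HasTree R m S' univ := fun S' hS' => by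
    by_contra hcon
    exact Nat.find_min hex (m := m) (by omega) ⟨S', hS', hcon⟩
  -- If `c` were undecided, both halves of `S` would be positive; their trees of height `m` would
  -- join at `c`.
  by_contra! hcon
  rw [hm] at hSn
  refine hSn ⟨c, mem_univ c, hmin _ ?_, hmin _ ?_⟩
  · rw [← inf_principal, ← inf_assoc, neBot_iff, Ne, inf_principal_eq_bot]
    exact hcon.2
  · rw [sdiff_eq, ← inf_principal, ← inf_assoc, neBot_iff, Ne, inf_principal_eq_bot, compl_compl]
    exact hcon.1

variable {L : FirstOrder.Language.{u, v}} {M : Type w} [L.Structure M] {X : Type x} {Y : Type y}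
  {φ : L.Formula (X ⊕ Y)} {A C : Set M} {B : Type z} [CompleteBooleanAlgebra B]

/-- A filter deciding all instances of `φ` decides all `φ`-formulas. -/
lemma mem_or_compl_mem_of_forall_instanceSet {G : Filter (X → M)}
    (hG : ∀ c : Y → M, instanceSet φ c ∈ G ∨ (instanceSet φ c)ᶜ ∈ G) {S : Set (X → M)}
    (hS : S ∈ phiAlgebra φ A C) : S ∈ G ∨ Sᶜ ∈ G := by
  have hS' : S ∈ BooleanSubalgebra.closure
      {S | ∃ c : Y → M, (∀ i, c i ∈ C) ∧ S = instanceSet φ c} := hS.2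
  clear hS
  induction hS' using BooleanSubalgebra.closure_bot_sup_induction with
  | mem S hS =>
    obtain ⟨c, -, rfl⟩ := hS
    exact hG c
  | bot => simp
  | sup S _ T _ h1 h2 =>
    rcases h1 with h1 | h1
    · exact Or.inl (mem_of_superset h1 subset_union_left)
    rcases h2 with h2 | h2
    · exact Or.inl (mem_of_superset h2 subset_union_right)
    · exact Or.inr (by simpa only [sup_eq_union, compl_union] using inter_mem h1 h2)
  | compl S _ h => simpa only [compl_compl] using h.symm

/-- Among the filters whose members in the algebra of `φ`-formulas are given a value above `b`
by `q`, there is a finest one. -/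
lemma exists_minimal_filter (q : BoolPhiType φ A C B) (b : B) :
    ∃ F : Filter (X → M), Minimal (fun F => ∀ e : phiAlgebra φ A C, e.1 ∈ F → b ≤ q e) F := by
  refine @zorn_le₀ (Filter (X → M))ᵒᵈ _
    {F : Filter (X → M) | ∀ e : phiAlgebra φ A C, e.1 ∈ F → b ≤ q e} fun c hcs hc => ?_
  rcases c.eq_empty_or_nonempty with rfl | hne
  · refine ⟨(⊤ : Filter (X → M)), fun e he => ?_, by simp⟩
    have : e = ⊤ := Subtype.ext (mem_top.1 he)
    simp [this]
  -- Along a chain, a set in the infimum filter already lies in one of the filters.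
  · have hd : DirectedOn (· ≥ ·) (show Set (Filter (X → M)) from c) := hc.directedOn
    refine ⟨(sInf (show Set (Filter (X → M)) from c) : Filter (X → M)), fun e he => ?_,
      fun F hF => sInf_le (α := Filter (X → M)) hF⟩
    rw [sInf_eq_iInf] at he
    obtain ⟨F, hF, heF⟩ := (mem_biInf_of_directed hd hne).1 he
    exact hcs hF e heF

lemma exists_le_decides {n : ℕ}
    (hn : ¬ HasTree (fun (a : X → M) (c : Y → M) => a ∈ instanceSet φ c) n univ univ)
    (q : BoolPhiType φ A C B) (b : B) (hb : b ≠ ⊥) : ∃ c ≤ b, Decides q c := by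
  obtain ⟨F, hF, hmin⟩ := exists_minimal_filter q b
  have : F.NeBot := by
    refine ⟨fun h => hb (le_bot_iff.1 ?_)⟩
    simpa using hF ⊥ (by simp [h])
  obtain ⟨S, hS, hdec⟩ := exists_positive_deciding hn F
  have hSF : Sᶜ ∉ F := fun h => hS.ne (inf_principal_eq_bot.2 h)
  obtain ⟨e, he, hbe⟩ : ∃ e : phiAlgebra φ A C, e.1 ∈ F ⊓ 𝓟 Sᶜ ∧ ¬ b ≤ q e := by
    by_contra! h
    exact hSF (hmin h inf_le_left (mem_inf_of_right (mem_principal_self _)))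
  -- Since `e` is large on `Sᶜ` and `ψ` on `S`, their join lies in `F`, so `b ≤ q e ⊔ q ψ`.
  have hle : ∀ ψ : phiAlgebra φ A C, ψ.1 ∈ F ⊓ 𝓟 S → b \ q e ≤ q ψ := fun ψ hψ => by
    rw [sdiff_le_iff, ← map_sup q e ψ]
    refine hF _ ?_
    rw [mem_inf_principal] at he hψ
    filter_upwards [he, hψ] with a h1 h2
    by_cases ha : a ∈ S
    · exact Or.inr (h2 ha)
    · exact Or.inl (h1 ha)
  exact ⟨b \ q e, sdiff_le, fun h => hbe (sdiff_eq_bot_iff.1 h), fun ψ =>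
    (mem_or_compl_mem_of_forall_instanceSet hdec ψ.2).imp (hle ψ) (hle ψᶜ)⟩

end Density

end BooleanType

theorem mainTheorem8 {L : FirstOrder.Language.{u, v}} (T : L.Theory) (hT : T.IsComplete)
    {M : Type w} [L.Structure M] [Nonempty M] (hM : M ⊨ T)
    {X : Type x} {Y : Type y} (φ : L.Formula (X ⊕ Y)) (hφ : BooleanType.IsStable T φ)
    (A C : Set M) (hAC : A ⊆ C) {B : Type z} [CompleteBooleanAlgebra B]
    (q : BooleanType.BoolPhiType φ A C B) :
    ∃ (U : Set (BooleanType.PhiType φ A C)) (b : U → B),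
      U ⊆ BooleanType.supp q ∧ BooleanType.IsMaximalAntichain b ∧
        ∀ ψ : BooleanType.phiAlgebra φ A C, q ψ = ⨆ r : U, b r ⊓ r.1.val B ψ := by

  obtain ⟨n, hn⟩ := hφ.exists_not_hasTree hM
  exact BooleanType.exists_maximalAntichain_of_dense q (BooleanType.exists_le_decides hn q)
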